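/- For every real number $\varepsilon$ with $0<\varepsilon<2$ there is a finite set $A\subseteq\mathbb{Z}$ such that $$|A-A|\ \ge\ |A|^{2-\varepsilon}\ >\ 1\qquad\text{and}\qquad |A+A|\ \le\ |A|^{1.7354+\varepsilon},$$ where $A-A=\{a-b : a,b\in A\}$ and $A+A=\{a+b : a,b\in A\}$. -/

import Mathlib

open scoped Pointwise

/-! The set is random. Fix a law on a few digits, let X, Y be independent with this law, draw 2k
vectors of d independent digits, and read them as integers in a large base. Let H be the entropy of
X - Y. Typical differences of two such vectors each have probability at most exp(-g d), for any g <
H. If k = exp(h d) with 2h < H, the k² differences between the two halves of the sample therefore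
rarely collide, and |A - A| is of order k² (`exists_sample_card_image_ge`,
`eventually_exists_finset`). Typical vectors also have digit sum at most l d, for any l above the
mean digit. So A + A comes from vectors of digit sum at most 2 l d, and a generating function bounds
their number by c ^ d (`card_filter_sum_le`). The sumset exponent is then log c / h. A law
concentrated near 0 makes it less than 1.7354; the constant factors lost on the way are absorbed by
ε. -/

/-! ### Large deviations for product weights. -/

theorem sum_pi_prod {ι α : Type*} [Fintype ι] [DecidableEq ι] [Fintype α] (f : ι → α → ℝ) :
    ∑ x : ι → α, ∏ i, f i (x i) = ∏ i, ∑ a, f i a := by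
  rw [Finset.prod_univ_sum, Fintype.piFinset_univ]

/-- Exponential moment bound for sums of independent variables of negative mean. -/
theorem exists_tail_sum_le_pow {α : Type*} [Fintype α] (w f : α → ℝ) (hw : ∀ a, 0 ≤ w a)
    (hsum : ∑ a, w a = 1) (hf : ∑ a, w a * f a < 0) :
    ∃ ρ : ℝ, 0 ≤ ρ ∧ ρ < 1 ∧ ∀ d : ℕ,
      (∑ x : Fin d → α, if 0 ≤ ∑ i, f (x i) then ∏ i, w (x i) else 0) ≤ ρ ^ d := by
  -- The moment generating function is 1 at t = 0 with negative derivative, so it drops below 1 at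
  -- some t > 0; its value there is ρ.
  have hder : HasDerivAt (fun t : ℝ => ∑ a, w a * Real.exp (t * f a)) (∑ a, w a * f a) 0 := by
    have h : ∀ a ∈ (Finset.univ : Finset α),
        HasDerivAt (fun t : ℝ => w a * Real.exp (t * f a)) (w a * f a) 0 := by
      intro a _
      have h1 : HasDerivAt (fun t : ℝ => t * f a) (1 * f a) 0 := (hasDerivAt_id 0).mul_const (f a)
      simpa using (h1.exp).const_mul (w a)
    simpa using HasDerivAt.fun_sum h
  have hlt := (hasDerivAt_iff_tendsto_slope.1 hder).eventually_lt_const hf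
  have hlt' := hlt.filter_mono
    (nhdsWithin_mono (0 : ℝ) (fun x (hx : x ∈ Set.Ioi (0 : ℝ)) => ne_of_gt hx))
  obtain ⟨t, ht, ht0⟩ := (hlt'.and self_mem_nhdsWithin).exists
  have ht0 : 0 < t := ht0
  refine ⟨∑ a, w a * Real.exp (t * f a),
    Finset.sum_nonneg fun a _ => mul_nonneg (hw a) (Real.exp_pos _).le, ?_, fun d => ?_⟩
  · rw [slope_def_field] at ht
    simp only [zero_mul, Real.exp_zero, mul_one, hsum, sub_zero] at ht
    have := (div_lt_iff₀ ht0).1 ht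
    linarith
  -- Chernoff: the indicator of S ≥ 0 is at most exp(t S), which factors over coordinates.
  · calc _ ≤ ∑ x : Fin d → α, ∏ i, (w (x i) * Real.exp (t * f (x i))) := by
          refine Finset.sum_le_sum fun x _ => ?_
          have hp : 0 ≤ ∏ i, w (x i) := Finset.prod_nonneg fun i _ => hw _
          rw [Finset.prod_mul_distrib, ← Real.exp_sum, ← Finset.mul_sum]
          split_ifs with h
          · exact le_mul_of_one_le_right hp (Real.one_le_exp (mul_nonneg ht0.le h))
          · exact mul_nonneg hp (Real.exp_pos _).le
      _ = _ := by
          rw [sum_pi_prod (fun _ a => w a * Real.exp (t * f a))]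
          simp

/-- Union bound: each of the finitely many conditions fails with exponentially small probability. -/
theorem eventually_half_le_sum_forall_sum_neg {α κ : Type*} [Fintype α] [Fintype κ] (w : α → ℝ)
    (f : κ → α → ℝ) (hw : ∀ a, 0 ≤ w a) (hsum : ∑ a, w a = 1)
    (hf : ∀ j, ∑ a, w a * f j a < 0) :
    ∀ᶠ d : ℕ in Filter.atTop,
      1 / 2 ≤ ∑ x : Fin d → α, if ∀ j, ∑ i, f j (x i) < 0 then ∏ i, w (x i) else 0 := by
  choose ρ h0 h1 hρ using fun j => exists_tail_sum_le_pow w (f j) hw hsum (hf j)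
  have hlim : Filter.Tendsto (fun d : ℕ => ∑ j, ρ j ^ d) Filter.atTop (nhds 0) := by
    simpa using tendsto_finsetSum (Finset.univ : Finset κ)
      fun j _ => tendsto_pow_atTop_nhds_zero_of_lt_one (h0 j) (h1 j)
  filter_upwards [hlim.eventually_lt_const (show (0 : ℝ) < 1 / 2 by norm_num)] with d hd
  have htot : ∑ x : Fin d → α, ∏ i, w (x i) = 1 := by
    rw [sum_pi_prod (fun _ a => w a)]; simp [hsum]
  have key : ∑ x : Fin d → α, ∏ i, w (x i) ≤
      (∑ x : Fin d → α, if ∀ j, ∑ i, f j (x i) < 0 then ∏ i, w (x i) else 0) +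
      ∑ j, ∑ x : Fin d → α, if 0 ≤ ∑ i, f j (x i) then ∏ i, w (x i) else 0 := by
    rw [Finset.sum_comm, ← Finset.sum_add_distrib]
    refine Finset.sum_le_sum fun x _ => ?_
    have hp : 0 ≤ ∏ i, w (x i) := Finset.prod_nonneg fun i _ => hw _
    have hnn : ∀ j ∈ (Finset.univ : Finset κ),
        0 ≤ if 0 ≤ ∑ i, f j (x i) then ∏ i, w (x i) else 0 := by
      intro j _; split_ifs <;> simp [hp]
    split_ifs with h
    · linarith [Finset.sum_nonneg hnn]
    · push Not at h
      obtain ⟨j, hj⟩ := h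
      have := Finset.single_le_sum hnn (Finset.mem_univ j)
      rw [if_pos hj] at this
      linarith
  have := Finset.sum_le_sum fun j (_ : j ∈ (Finset.univ : Finset κ)) => hρ j d
  linarith

/-! ### Random samples and collisions of differences. -/

/-- Resampling one coordinate does not change a product-weighted sum. -/
theorem sum_prod_resample {ι V : Type*} [Fintype ι] [DecidableEq ι] [Fintype V] (W : V → ℝ)
    (hsum : ∑ v, W v = 1) (i : ι) (F : (ι → V) → ℝ) :
    ∑ x : ι → V, (∏ j, W (x j)) * ∑ a, W a * F (Function.update x i a) =
      ∑ x : ι → V, (∏ j, W (x j)) * F x := by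
  -- Exchanging coordinate i with the fresh sample is an involution preserving the product weight.
  let e : (ι → V) × V → (ι → V) × V := fun p => (Function.update p.1 i p.2, p.1 i)
  have he : Function.Involutive e := fun p => by simp [e]
  have hprod : ∀ (x : ι → V) (a : V),
      (∏ j, W (Function.update x i a j)) * W (x i) = (∏ j, W (x j)) * W a := by
    intro x a
    rw [← Finset.mul_prod_erase _ _ (Finset.mem_univ i),
      ← Finset.mul_prod_erase _ (fun j => W (x j)) (Finset.mem_univ i)]
    have : ∏ j ∈ Finset.univ.erase i, W (Function.update x i a j) =
        ∏ j ∈ Finset.univ.erase i, W (x j) :=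
      Finset.prod_congr rfl fun j hj => by
        rw [Function.update_of_ne (Finset.ne_of_mem_erase hj)]
    rw [this, Function.update_self]
    ring
  calc _ = ∑ p : (ι → V) × V, (∏ j, W (p.1 j)) * W p.2 * F (Function.update p.1 i p.2) := by
        rw [Fintype.sum_prod_type]
        simp only [Finset.mul_sum, mul_assoc]
    _ = ∑ p : (ι → V) × V, (∏ j, W (p.1 j)) * W p.2 * F p.1 := by
        refine Fintype.sum_equiv he.toPerm _ _ fun p => ?_
        simp only [Function.Involutive.coe_toPerm, e, hprod]
    _ = _ := by
        rw [Fintype.sum_prod_type]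
        refine Finset.sum_congr rfl fun x _ => ?_
        simp only []
        rw [← Finset.sum_mul, ← Finset.mul_sum, hsum, mul_one]

theorem sum_prod_mul_le {ι V : Type*} [Fintype ι] [DecidableEq ι] [Fintype V] (W : V → ℝ)
    (hW : ∀ v, 0 ≤ W v) (hsum : ∑ v, W v = 1) (F : (ι → V) → ℝ) (c : ℝ) (hF : ∀ x, F x ≤ c) :
    ∑ x : ι → V, (∏ j, W (x j)) * F x ≤ c := by
  calc _ ≤ ∑ x : ι → V, (∏ j, W (x j)) * c :=
        Finset.sum_le_sum fun x _ =>
          mul_le_mul_of_nonneg_left (hF x) (Finset.prod_nonneg fun _ _ => hW _)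
    _ = c := by
        rw [← Finset.sum_mul, sum_pi_prod (fun _ a => W a)]
        simp [hsum]

/-- Good points that share their value with no other point inject into the image; every other good
point is paid for by at least one collision. -/
theorem card_filter_sub_le_card_image {P β : Type*} [Fintype P] [DecidableEq P] [DecidableEq β]
    (good : P → Prop) [DecidablePred good] (D : P → β) :
    ((Finset.univ.filter good).card : ℝ) -
      ∑ p : P, ∑ q : P, (if p ≠ q ∧ good p ∧ D p = D q then (1 : ℝ) else 0) ≤
      (((Finset.univ.filter good).image D).card : ℝ) := by
  classical
  set S := Finset.univ.filter fun p => good p ∧ ∀ q, p ≠ q → D p ≠ D q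
  have hinj : Set.InjOn D S := by
    intro p hp q _ hpq
    by_contra hne
    exact (Finset.mem_filter.1 hp).2.2 q hne hpq
  have h1 : S.card ≤ ((Finset.univ.filter good).image D).card := by
    rw [← Finset.card_image_of_injOn hinj]
    refine Finset.card_le_card (Finset.image_subset_image fun p hp => ?_)
    simp only [S, Finset.mem_filter, Finset.mem_univ, true_and] at hp ⊢
    exact hp.1
  have h2 : ((Finset.univ.filter good).card : ℝ) ≤ (S.card : ℝ) +
      ∑ p : P, ∑ q : P, (if p ≠ q ∧ good p ∧ D p = D q then (1 : ℝ) else 0) := by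
    simp only [S, Finset.card_filter, Nat.cast_sum]
    rw [← Finset.sum_add_distrib]
    refine Finset.sum_le_sum fun p _ => ?_
    have hnn : ∀ q ∈ (Finset.univ : Finset P),
        (0 : ℝ) ≤ if p ≠ q ∧ good p ∧ D p = D q then (1 : ℝ) else 0 := by
      intro q _; split_ifs <;> norm_num
    have h0 := Finset.sum_nonneg hnn
    by_cases hp : good p
    · by_cases hq : ∀ q, p ≠ q → D p ≠ D q
      · rw [if_pos hp, if_pos ⟨hp, hq⟩]; push_cast; linarith
      · rw [if_pos hp, if_neg (fun h => hq h.2)]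
        push Not at hq
        obtain ⟨q, hne, hD⟩ := hq
        have := Finset.single_le_sum hnn (Finset.mem_univ q)
        rw [if_pos ⟨hne, hp, hD⟩] at this
        push_cast; linarith
    · rw [if_neg hp, if_neg (fun h => hp h.1)]; push_cast; linarith
  have h1' : (S.card : ℝ) ≤ (((Finset.univ.filter good).image D).card : ℝ) := by exact_mod_cast h1
  linarith

/-- Two independent samples of `k` points have many distinct differences along good pairs. -/
theorem exists_sample_card_image_ge {V β : Type*} [Fintype V] [DecidableEq β] (W : V → ℝ)
    (hW : ∀ v, 0 ≤ W v) (hsum : ∑ v, W v = 1) (good : V → V → Prop) [∀ a b, Decidable (good a b)]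
    (D : V → V → β) (k : ℕ) (R η : ℝ) (hR : 8 * (k : ℝ) ^ 2 * R ≤ 1) (hη : 16 * (k : ℝ) * η ≤ 1)
    (hgood : 1 / 2 ≤ ∑ a, ∑ b, if good a b then W a * W b else 0)
    (hD : ∀ s, (∑ a, ∑ b, if good a b ∧ D a b = s then W a * W b else 0) ≤ R)
    (hl : ∀ a s, (∑ b, if good a b ∧ D a b = s then W b else 0) ≤ η)
    (hr : ∀ b s, (∑ a, if good a b ∧ D a b = s then W a else 0) ≤ η) :
    ∃ ω : Fin k ⊕ Fin k → V, (k : ℝ) ^ 2 / 4 ≤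
      (((Finset.univ.filter fun p : Fin k × Fin k => good (ω (.inl p.1)) (ω (.inr p.2))).image
        fun p => D (ω (.inl p.1)) (ω (.inr p.2))).card : ℝ) := by
  classical
  set X := Fin k ⊕ Fin k → V
  set P : X → ℝ := fun ω => ∏ j, W (ω j)
  have two : ∀ (p : Fin k × Fin k) (F : X → ℝ), ∑ ω : X, P ω * F ω =
      ∑ ω : X, P ω * ∑ a, W a * ∑ b, W b *
        F (Function.update (Function.update ω (.inl p.1) a) (.inr p.2) b) := by
    intro p F
    rw [← sum_prod_resample W hsum (.inr p.2) F,
      ← sum_prod_resample W hsum (.inl p.1)]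
  have hone : ∑ ω : X, P ω = 1 := by
    simp only [P, X]
    rw [sum_pi_prod (fun _ a => W a)]; simp [hsum]
  have hP : ∀ ω, 0 ≤ P ω := fun ω => Finset.prod_nonneg fun _ _ => hW _
  have hN : ∀ p : Fin k × Fin k, 1 / 2 ≤ ∑ ω : X, P ω *
      (if good (ω (.inl p.1)) (ω (.inr p.2)) then 1 else 0) := by
    intro p
    rw [two p]
    simp only [Function.update_self, Function.update_of_ne (show (Sum.inl p.1 : Fin k ⊕ Fin k) ≠
      .inr p.2 by simp)]
    rw [← Finset.sum_mul, hone, one_mul]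
    refine hgood.trans_eq ?_
    refine Finset.sum_congr rfl fun a _ => ?_
    rw [Finset.mul_sum]
    refine Finset.sum_congr rfl fun b _ => ?_
    split_ifs <;> simp
  -- Pairs with no common index collide with probability at most R. With one common index,
  -- resampling the other endpoint of p gives η. The case p = q contributes nothing.
  have hC : ∀ p q : Fin k × Fin k, ∑ ω : X, P ω *
      (if p ≠ q ∧ good (ω (.inl p.1)) (ω (.inr p.2)) ∧
        D (ω (.inl p.1)) (ω (.inr p.2)) = D (ω (.inl q.1)) (ω (.inr q.2)) then 1 else 0) ≤
      R + (if p.1 = q.1 then η else 0) + (if p.2 = q.2 then η else 0) := by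
    rintro ⟨i, j⟩ ⟨i', j'⟩
    have hR0 : 0 ≤ R := by
      obtain ⟨a, -, -⟩ := Finset.exists_ne_zero_of_sum_ne_zero (hsum.trans_ne one_ne_zero)
      refine le_trans ?_ (hD (D a a))
      exact Finset.sum_nonneg fun a _ => Finset.sum_nonneg fun b _ => by
        split_ifs
        · exact mul_nonneg (hW _) (hW _)
        · exact le_rfl
    by_cases hi : i = i'
    · subst hi
      have hη0 : 0 ≤ η := by
        obtain ⟨a, -, -⟩ := Finset.exists_ne_zero_of_sum_ne_zero (hsum.trans_ne one_ne_zero)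
        refine le_trans ?_ (hl a (D a a))
        exact Finset.sum_nonneg fun b _ => by split_ifs; exacts [hW _, le_rfl]
      by_cases hj : j = j'
      · subst hj
        simp
        linarith
      · rw [← sum_prod_resample W hsum (.inr j)]
        simp only [if_neg hj, if_true, add_zero]
        refine (sum_prod_mul_le W hW hsum _ η fun ω => ?_).trans (by linarith)
        refine le_trans (Finset.sum_le_sum fun b _ => ?_)
          (hl (ω (.inl i)) (D (ω (.inl i)) (ω (.inr j'))))
        simp only [Function.update_self, ne_eq, reduceCtorEq, not_false_eq_true,
          Function.update_of_ne, Sum.inr.injEq, Ne.symm hj, Prod.mk.injEq, hj, and_false,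
          true_and]
        split_ifs <;> simp
    · by_cases hj : j = j'
      · subst hj
        rw [← sum_prod_resample W hsum (.inl i)]
        simp only [if_neg hi, if_true, add_zero]
        refine (sum_prod_mul_le W hW hsum _ η fun ω => ?_).trans (by linarith)
        refine le_trans (Finset.sum_le_sum fun b _ => ?_)
          (hr (ω (.inr j)) (D (ω (.inl i')) (ω (.inr j))))
        simp only [Function.update_self, ne_eq, reduceCtorEq, not_false_eq_true,
          Function.update_of_ne, Sum.inl.injEq, Ne.symm hi, Prod.mk.injEq, hi, false_and,
          true_and]
        split_ifs <;> simp
      · rw [two (i, j)]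
        simp only [if_neg hi, if_neg hj, add_zero]
        refine sum_prod_mul_le W hW hsum _ R fun ω => ?_
        refine le_trans (Finset.sum_le_sum fun a _ => ?_)
          (hD (D (ω (.inl i')) (ω (.inr j'))))
        rw [Finset.mul_sum]
        refine Finset.sum_le_sum fun b _ => ?_
        simp only [Function.update_self, ne_eq, reduceCtorEq, not_false_eq_true,
          Function.update_of_ne, Sum.inl.injEq, Sum.inr.injEq, Ne.symm hi, Ne.symm hj,
          Prod.mk.injEq, hi, false_and, true_and]
        split_ifs <;> simp
  by_contra hcon
  push Not at hcon
  have hlt : ∀ ω : X, (∑ p : Fin k × Fin k,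
      (if good (ω (.inl p.1)) (ω (.inr p.2)) then (1 : ℝ) else 0)) -
      ∑ p : Fin k × Fin k, ∑ q : Fin k × Fin k,
        (if p ≠ q ∧ good (ω (.inl p.1)) (ω (.inr p.2)) ∧
        D (ω (.inl p.1)) (ω (.inr p.2)) = D (ω (.inl q.1)) (ω (.inr q.2)) then (1 : ℝ) else 0) <
      (k : ℝ) ^ 2 / 4 := by
    intro ω
    refine lt_of_le_of_lt ?_ (hcon ω)
    have := card_filter_sub_le_card_image
      (fun p : Fin k × Fin k => good (ω (.inl p.1)) (ω (.inr p.2)))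
      (fun p => D (ω (.inl p.1)) (ω (.inr p.2)))
    rw [Finset.card_filter] at this
    push_cast at this
    exact this
  have hE : ∑ ω : X, P ω * ((∑ p : Fin k × Fin k,
      (if good (ω (.inl p.1)) (ω (.inr p.2)) then (1 : ℝ) else 0)) -
      ∑ p : Fin k × Fin k, ∑ q : Fin k × Fin k,
        (if p ≠ q ∧ good (ω (.inl p.1)) (ω (.inr p.2)) ∧
        D (ω (.inl p.1)) (ω (.inr p.2)) = D (ω (.inl q.1)) (ω (.inr q.2)) then (1 : ℝ) else 0)) <
      (k : ℝ) ^ 2 / 4 := by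
    calc _ < ∑ ω : X, P ω * ((k : ℝ) ^ 2 / 4) := by
          obtain ⟨ω, -, hω⟩ := Finset.exists_ne_zero_of_sum_ne_zero (hone.trans_ne one_ne_zero)
          exact Finset.sum_lt_sum (fun ω _ => mul_le_mul_of_nonneg_left (hlt ω).le (hP ω))
            ⟨ω, Finset.mem_univ _, mul_lt_mul_of_pos_left (hlt ω) ((hP ω).lt_of_ne' hω)⟩
      _ = _ := by rw [← Finset.sum_mul, hone, one_mul]
  simp only [mul_sub, Finset.sum_sub_distrib, Finset.mul_sum] at hE
  rw [Finset.sum_comm, Finset.sum_comm (s := (Finset.univ : Finset X))] at hE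
  have h1 : (k : ℝ) ^ 2 * (1 / 2) ≤ ∑ p : Fin k × Fin k, ∑ ω : X, P ω *
      (if good (ω (.inl p.1)) (ω (.inr p.2)) then 1 else 0) := by
    refine le_trans (le_of_eq ?_) (Finset.sum_le_sum fun p _ => hN p)
    simp; ring
  have h2 : ∑ p : Fin k × Fin k, ∑ ω : X, ∑ q : Fin k × Fin k, P ω *
      (if p ≠ q ∧ good (ω (.inl p.1)) (ω (.inr p.2)) ∧
        D (ω (.inl p.1)) (ω (.inr p.2)) = D (ω (.inl q.1)) (ω (.inr q.2)) then (1 : ℝ) else 0) ≤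
      (k : ℝ) ^ 2 * ((k : ℝ) ^ 2 * R + k * η + k * η) := by
    calc _ ≤ ∑ p : Fin k × Fin k, ∑ q : Fin k × Fin k,
          (R + (if p.1 = q.1 then η else 0) + (if p.2 = q.2 then η else 0)) := by
          refine Finset.sum_le_sum fun p _ => ?_
          rw [Finset.sum_comm]
          exact Finset.sum_le_sum fun q _ => hC p q
      _ = _ := by
          have e1 : ∀ p : Fin k × Fin k,
              ∑ q : Fin k × Fin k, (if p.1 = q.1 then η else 0) = k * η := by
            intro p; rw [Fintype.sum_prod_type_right]; simp
          have e2 : ∀ p : Fin k × Fin k,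
              ∑ q : Fin k × Fin k, (if p.2 = q.2 then η else 0) = k * η := by
            intro p; rw [Fintype.sum_prod_type]; simp
          simp only [Finset.sum_add_distrib, e1, e2, Finset.sum_const, Finset.card_univ,
            Fintype.card_prod, Fintype.card_fin, nsmul_eq_mul]
          push_cast
          ring
  -- k² R ≤ 1/8 and 2kη ≤ 1/8, so the expected count of good pairs minus collisions is at least k²/2
  -- - k²/4, contradicting `hE`.
  have h3 : (k : ℝ) ^ 2 * ((k : ℝ) ^ 2 * R + k * η + k * η) ≤ (k : ℝ) ^ 2 * (1 / 4) :=
    mul_le_mul_of_nonneg_left (by linarith) (by positivity)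
  linarith

/-! ### Encoding digit vectors as integers. -/

/-- The lowest digit is divisible by B and smaller than B in absolute value, hence zero; divide by B
and induct. -/
theorem eq_zero_of_sum_mul_pow_eq_zero (B : ℤ) :
    ∀ {d : ℕ} (e : Fin d → ℤ), (∀ i, |e i| < B) → ∑ i, e i * B ^ (i : ℕ) = 0 → ∀ i, e i = 0
  | 0, _, _, _ => fun i => i.elim0
  | d + 1, e, he, h => by
    have hB : 0 < B := (abs_nonneg _).trans_lt (he 0)
    have hs : ∑ i : Fin d, e i.succ * B ^ ((i.succ : Fin (d + 1)) : ℕ) =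
        B * ∑ i : Fin d, e i.succ * B ^ (i : ℕ) := by
      rw [Finset.mul_sum]
      exact Finset.sum_congr rfl fun i _ => by rw [Fin.val_succ]; ring
    rw [Fin.sum_univ_succ, hs] at h
    simp only [Fin.val_zero, pow_zero, mul_one] at h
    have h0 : e 0 = 0 := Int.eq_zero_of_abs_lt_dvd (m := B)
      ⟨-∑ i : Fin d, e i.succ * B ^ (i : ℕ), by linear_combination h⟩ (he 0)
    rw [h0, zero_add] at h
    have h1 := eq_zero_of_sum_mul_pow_eq_zero B (fun i : Fin d => e i.succ)
      (fun i => he i.succ) ((mul_eq_zero.1 h).resolve_left hB.ne')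
    exact fun i => Fin.cases h0 h1 i

/-- Evaluation of a digit vector in base `B`. -/
def digitEval (B : ℤ) {d m : ℕ} (a : Fin d → Fin m) : ℤ := ∑ i, ((a i : ℕ) : ℤ) * B ^ (i : ℕ)

/-- The digits of the combination a - b - (a' - b') are at most 2K in absolute value, below the
base. -/
theorem digitEval_sub_eq_sub {d K : ℕ} {a b a' b' : Fin d → Fin (K + 1)}
    (h : digitEval (4 * K + 1) a - digitEval (4 * K + 1) b =
      digitEval (4 * K + 1) a' - digitEval (4 * K + 1) b') (i : Fin d) :
    ((a i : ℕ) : ℤ) - ((b i : ℕ) : ℤ) = ((a' i : ℕ) : ℤ) - ((b' i : ℕ) : ℤ) := by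
  have := eq_zero_of_sum_mul_pow_eq_zero (4 * K + 1)
    (fun i => ((a i : ℕ) : ℤ) - ((b i : ℕ) : ℤ) - (((a' i : ℕ) : ℤ) - ((b' i : ℕ) : ℤ)))
    (fun i => by rw [abs_lt]; constructor <;> omega)
    (by
      simp only [sub_mul, Finset.sum_sub_distrib]
      simp only [digitEval] at h
      linarith) i
  linarith

theorem digitEval_injective {d K : ℕ} :
    Function.Injective (digitEval (4 * K + 1) : (Fin d → Fin (K + 1)) → ℤ) := by
  intro a b h
  funext i
  have := digitEval_sub_eq_sub (b := a) (b' := a) (congrArg (· - digitEval (4 * K + 1) a) h) i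
  exact Fin.ext (by omega)

/-- Rankin's trick: the indicator is at most z to the power (digit sum - L d). This factors, and
each factor is bounded by a full geometric series. -/
theorem card_filter_sum_le {d m : ℕ} (L z : ℝ) (hz0 : 0 < z) (hz1 : z < 1) :
    ((Finset.univ.filter fun s : Fin d → Fin m => ∑ i, ((s i : ℕ) : ℝ) ≤ L * d).card : ℝ) ≤
      ((1 - z)⁻¹ * z ^ (-L)) ^ d := by
  calc _ ≤ ∑ s : Fin d → Fin m, ∏ i, (z ^ (-L) * z ^ (s i : ℕ)) := by
        rw [Finset.card_filter]
        push_cast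
        refine Finset.sum_le_sum fun s _ => ?_
        have hnn : 0 ≤ ∏ i, (z ^ (-L) * z ^ (s i : ℕ)) :=
          Finset.prod_nonneg fun i _ => by positivity
        split_ifs with h
        · rw [Finset.prod_mul_distrib, Finset.prod_const, Finset.prod_pow_eq_pow_sum,
            Finset.card_univ, Fintype.card_fin, ← Real.rpow_natCast, ← Real.rpow_natCast,
            ← Real.rpow_mul hz0.le, ← Real.rpow_add hz0]
          refine Real.one_le_rpow_of_pos_of_le_one_of_nonpos hz0 hz1.le ?_
          push_cast
          linarith
        · exact hnn
    _ = (∑ j : Fin m, z ^ (-L) * z ^ (j : ℕ)) ^ d := by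
        rw [sum_pi_prod (fun _ j => z ^ (-L) * z ^ ((j : Fin m) : ℕ))]; simp
    _ ≤ _ := by
        refine pow_le_pow_left₀ (Finset.sum_nonneg fun j _ => by positivity) ?_ d
        rw [← Finset.mul_sum, mul_comm]
        refine mul_le_mul_of_nonneg_right ?_ (by positivity)
        rw [Fin.sum_univ_eq_sum_range (fun j => z ^ j)]
        rw [← tsum_geometric_of_lt_one hz0.le hz1]
        exact (summable_geometric_of_lt_one hz0.le hz1).sum_le_tsum _ fun _ _ => by positivity

/-! ### The difference law and the random construction. -/

/-- The law of the difference of two independent variables with weights `w`. -/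
noncomputable def diffLaw {K : ℕ} (w : Fin (K + 1) → ℝ) (s : ℤ) : ℝ :=
  ∑ p : Fin (K + 1) × Fin (K + 1),
    if ((p.1 : ℕ) : ℤ) - ((p.2 : ℕ) : ℤ) = s then w p.1 * w p.2 else 0

theorem diffLaw_sub_pos {K : ℕ} {w : Fin (K + 1) → ℝ} (hw : ∀ a, 0 < w a) (a b : Fin (K + 1)) :
    0 < diffLaw w (((a : ℕ) : ℤ) - ((b : ℕ) : ℤ)) := by
  refine Finset.sum_pos' (fun p _ => ?_) ⟨(a, b), Finset.mem_univ _, ?_⟩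
  · split_ifs
    · exact (mul_pos (hw _) (hw _)).le
    · exact le_rfl
  · simpa using mul_pos (hw a) (hw b)

/-- A pair of vectors is a vector of independent pairs, so the law of the difference vector is a
product. -/
theorem sum_ite_sub_eq_prod_diffLaw {K d : ℕ} (w : Fin (K + 1) → ℝ) (s : Fin d → ℤ) :
    (∑ a : Fin d → Fin (K + 1), ∑ b : Fin d → Fin (K + 1),
      if ∀ i, ((a i : ℕ) : ℤ) - ((b i : ℕ) : ℤ) = s i then (∏ i, w (a i)) * ∏ i, w (b i) else 0) =
      ∏ i, diffLaw w (s i) := by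
  simp only [diffLaw]
  rw [← sum_pi_prod (fun i (p : Fin (K + 1) × Fin (K + 1)) =>
    if ((p.1 : ℕ) : ℤ) - ((p.2 : ℕ) : ℤ) = s i then w p.1 * w p.2 else 0),
    ← Fintype.sum_prod_type']
  refine Fintype.sum_equiv (Equiv.arrowProdEquivProdArrow _ _ _).symm _ _ fun x => ?_
  rw [Finset.prod_ite_zero]
  simp [Equiv.arrowProdEquivProdArrow, Finset.prod_mul_distrib]

theorem prod_eq_exp_sum_log {d : ℕ} (f : Fin d → ℝ) (hf : ∀ i, 0 < f i) :
    ∏ i, f i = Real.exp (∑ i, Real.log (f i)) := by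
  rw [Real.exp_sum]
  exact Finset.prod_congr rfl fun i _ => (Real.exp_log (hf i)).symm

theorem sum_le_of_subsingleton_support {V : Type*} [Fintype V] (p : V → Prop) [DecidablePred p]
    (f : V → ℝ) (c : ℝ) (hc : 0 ≤ c) (hf : ∀ v, p v → f v ≤ c) (hp : ∀ u v, p u → p v → u = v) :
    (∑ v, if p v then f v else 0) ≤ c := by
  rw [← Finset.sum_filter]
  have hcard : (Finset.univ.filter p).card ≤ 1 :=
    Finset.card_le_one.2 fun u hu v hv =>
      hp u v (Finset.mem_filter.1 hu).2 (Finset.mem_filter.1 hv).2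
  refine (Finset.sum_le_card_nsmul _ f c fun v hv => hf v (Finset.mem_filter.1 hv).2).trans ?_
  rw [nsmul_eq_mul]
  exact mul_le_of_le_one_left hc (by exact_mod_cast hcard)

/-- A random set of digit vectors of small mean, with `exp (h * d)` elements, has almost
distinct differences as long as `2 * h` is below the entropy of the difference law. -/
theorem eventually_exists_finset {K : ℕ} (w : Fin (K + 1) → ℝ) (hw : ∀ a, 0 < w a)
    (hsum : ∑ a, w a = 1) (l h : ℝ) (hmean : ∑ a, w a * (a : ℕ) < l)
    (hent : ∑ a, w a * Real.log (w a) < -h)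
    (hdiff : ∑ a, ∑ b, w a * w b *
      Real.log (diffLaw w (((a : ℕ) : ℤ) - ((b : ℕ) : ℤ))) < -(2 * h)) :
    ∀ᶠ d : ℕ in Filter.atTop, ∀ k : ℕ, (k : ℝ) ≤ Real.exp (h * d) →
      ∃ A : Finset ℤ, (A.card : ℝ) ≤ 2 * k ∧ (k : ℝ) ^ 2 / 4 ≤ (A - A).card ∧
        ∀ z : ℝ, 0 < z → z < 1 →
          ((A + A).card : ℝ) ≤ ((1 - z)⁻¹ * z ^ (-(2 * l))) ^ d := by
  classical
  -- The gaps h' - h and g - 2h give the exponential decay that beats the constants 16 and 8.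
  obtain ⟨h', hh', hent'⟩ : ∃ h', h < h' ∧ ∑ a, w a * Real.log (w a) < -h' := by
    obtain ⟨y, hy1, hy2⟩ := exists_between hent
    exact ⟨-y, by linarith, by linarith⟩
  obtain ⟨g, hg, hdiff'⟩ : ∃ g, 2 * h < g ∧ ∑ a, ∑ b, w a * w b *
      Real.log (diffLaw w (((a : ℕ) : ℤ) - ((b : ℕ) : ℤ))) < -g := by
    obtain ⟨y, hy1, hy2⟩ := exists_between hdiff
    exact ⟨-y, by linarith, by linarith⟩
  let α := Fin (K + 1)
  -- A pair is good when both digit sums are small and both points, as well as their difference,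
  -- have typically small probability.
  let f : Fin 5 → α × α → ℝ := ![fun p => (p.1 : ℕ) - l, fun p => (p.2 : ℕ) - l,
    fun p => Real.log (w p.1) + h', fun p => Real.log (w p.2) + h',
    fun p => Real.log (diffLaw w (((p.1 : ℕ) : ℤ) - ((p.2 : ℕ) : ℤ))) + g]
  have hone : ∑ p : α × α, w p.1 * w p.2 = 1 := by
    rw [Fintype.sum_prod_type]
    change ∑ a : Fin (K + 1), ∑ b : Fin (K + 1), w a * w b = 1
    simp only [← Finset.mul_sum, hsum, mul_one]
  have hfst : ∀ u : α → ℝ, ∑ p : α × α, w p.1 * w p.2 * u p.1 = ∑ a, w a * u a := by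
    intro u
    rw [Fintype.sum_prod_type]
    refine Finset.sum_congr rfl fun a _ => ?_
    simp only []
    rw [← Finset.sum_mul, ← Finset.mul_sum, hsum, mul_one]
  have hsnd : ∀ u : α → ℝ, ∑ p : α × α, w p.1 * w p.2 * u p.2 = ∑ a, w a * u a := by
    intro u
    rw [Fintype.sum_prod_type_right]
    refine Finset.sum_congr rfl fun a _ => ?_
    simp only []
    rw [← Finset.sum_mul, ← Finset.sum_mul, hsum, one_mul]
  have hfneg : ∀ j, ∑ p : α × α, w p.1 * w p.2 * f j p < 0 := by
    have e1 : ∑ a, w a * (((a : ℕ) : ℝ) - l) < 0 := by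
      simp only [mul_sub, Finset.sum_sub_distrib, ← Finset.sum_mul, hsum]; linarith
    have e2 : ∑ a, w a * (Real.log (w a) + h') < 0 := by
      simp only [mul_add, Finset.sum_add_distrib, ← Finset.sum_mul, hsum]; linarith
    intro j
    fin_cases j
    · exact (hfst fun a => ((a : ℕ) : ℝ) - l).trans_lt e1
    · exact (hsnd fun a => ((a : ℕ) : ℝ) - l).trans_lt e1
    · exact (hfst fun a => Real.log (w a) + h').trans_lt e2
    · exact (hsnd fun a => Real.log (w a) + h').trans_lt e2
    · change ∑ p : α × α, w p.1 * w p.2 *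
        (Real.log (diffLaw w (((p.1 : ℕ) : ℤ) - ((p.2 : ℕ) : ℤ))) + g) < 0
      simp only [mul_add, Finset.sum_add_distrib, ← Finset.sum_mul, hone]
      rw [Fintype.sum_prod_type]
      linarith
  have hlarge : ∀ c : ℝ, 0 < c → ∀ᶠ d : ℕ in Filter.atTop, 16 * Real.exp (-(c * d)) ≤ 1 := by
    intro c hc
    have ht : Filter.Tendsto (fun d : ℕ => 16 * Real.exp (-(c * d))) Filter.atTop (nhds 0) := by
      have := (Real.tendsto_exp_neg_atTop_nhds_zero.comp
        (tendsto_natCast_atTop_atTop.const_mul_atTop hc)).const_mul (16 : ℝ)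
      simpa [Function.comp_def] using this
    filter_upwards [ht.eventually_lt_const one_pos] with d hd using hd.le
  filter_upwards [eventually_half_le_sum_forall_sum_neg (fun p : α × α => w p.1 * w p.2) f
    (fun p => (mul_pos (hw _) (hw _)).le) hone hfneg, hlarge (h' - h) (by linarith),
    hlarge (g - 2 * h) (by linarith)] with d hd hd1 hd2 k hk
  let V := Fin d → α
  let W : V → ℝ := fun v => ∏ i, w (v i)
  let good : V → V → Prop := fun a b => ∀ j, ∑ i, f j (a i, b i) < 0
  have hW : ∀ v, 0 ≤ W v := fun v => Finset.prod_nonneg fun i _ => (hw _).le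
  have hWsum : ∑ v, W v = 1 := by
    simp only [W]; rw [sum_pi_prod (fun _ a => w a)]; simp [hsum]
  have hmean1 : ∀ a b, good a b → ∑ i, ((a i : ℕ) : ℝ) ≤ l * d := by
    intro a b hab
    have := hab 0
    simp only [f, Matrix.cons_val, Finset.sum_sub_distrib, Finset.sum_const,
      Finset.card_univ, Fintype.card_fin, nsmul_eq_mul] at this
    linarith
  have hmean2 : ∀ a b, good a b → ∑ i, ((b i : ℕ) : ℝ) ≤ l * d := by
    intro a b hab
    have := hab 1
    simp only [f, Matrix.cons_val, Finset.sum_sub_distrib, Finset.sum_const,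
      Finset.card_univ, Fintype.card_fin, nsmul_eq_mul] at this
    linarith
  have hW1 : ∀ a b, good a b → W a ≤ Real.exp (-(h' * d)) := by
    intro a b hab
    have := hab 2
    simp only [f, Matrix.cons_val, Finset.sum_add_distrib, Finset.sum_const,
      Finset.card_univ, Fintype.card_fin, nsmul_eq_mul] at this
    simp only [W]
    rw [prod_eq_exp_sum_log _ fun i => hw _]
    exact Real.exp_le_exp.2 (by linarith)
  have hW2 : ∀ a b, good a b → W b ≤ Real.exp (-(h' * d)) := by
    intro a b hab
    have := hab 3
    simp only [f, Matrix.cons_val, Finset.sum_add_distrib, Finset.sum_const,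
      Finset.card_univ, Fintype.card_fin, nsmul_eq_mul] at this
    simp only [W]
    rw [prod_eq_exp_sum_log _ fun i => hw _]
    exact Real.exp_le_exp.2 (by linarith)
  have hWd : ∀ a b, good a b →
      ∏ i, diffLaw w (((a i : ℕ) : ℤ) - ((b i : ℕ) : ℤ)) ≤ Real.exp (-(g * d)) := by
    intro a b hab
    have := hab 4
    simp only [f, Matrix.cons_val, Finset.sum_add_distrib, Finset.sum_const,
      Finset.card_univ, Fintype.card_fin, nsmul_eq_mul] at this
    rw [prod_eq_exp_sum_log _ fun i => diffLaw_sub_pos hw _ _]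
    exact Real.exp_le_exp.2 (by linarith)
  let B : ℤ := 4 * K + 1
  have hgood : 1 / 2 ≤ ∑ a, ∑ b, if good a b then W a * W b else 0 := by
    refine hd.trans_eq ?_
    rw [← Fintype.sum_prod_type']
    refine Fintype.sum_equiv (Equiv.arrowProdEquivProdArrow _ _ _) _ _ fun x => ?_
    simp [good, W, Equiv.arrowProdEquivProdArrow, Finset.prod_mul_distrib]
  have hexp : (k : ℝ) ^ 2 ≤ Real.exp (2 * h * d) := by
    calc (k : ℝ) ^ 2 ≤ Real.exp (h * d) ^ 2 := pow_le_pow_left₀ (by positivity) hk 2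
      _ = _ := by rw [← Real.exp_nat_mul]; congr 1; push_cast; ring
  obtain ⟨ω, hω⟩ := exists_sample_card_image_ge W hW hWsum good
    (fun a b => digitEval B a - digitEval B b) k (Real.exp (-(g * d))) (Real.exp (-(h' * d)))
    (by
      calc 8 * (k : ℝ) ^ 2 * Real.exp (-(g * d)) ≤
            8 * Real.exp (2 * h * d) * Real.exp (-(g * d)) := by gcongr
        _ = 8 * Real.exp (-((g - 2 * h) * d)) := by
            rw [mul_assoc, ← Real.exp_add]; congr 2; ring
        _ ≤ 1 := by linarith [Real.exp_pos (-((g - 2 * h) * d))])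
    (by
      calc 16 * (k : ℝ) * Real.exp (-(h' * d)) ≤
            16 * Real.exp (h * d) * Real.exp (-(h' * d)) := by gcongr
        _ = 16 * Real.exp (-((h' - h) * d)) := by
            rw [mul_assoc, ← Real.exp_add]; congr 2; ring
        _ ≤ 1 := hd1)
    hgood
    (by
      intro s
      -- A value s attained by one good pair has small total probability under the difference law;
      -- otherwise the sum is empty.
      by_cases hex : ∃ a b, good a b ∧ digitEval B a - digitEval B b = s
      · obtain ⟨a₀, b₀, hab, hs⟩ := hex
        refine le_trans ?_ (hWd a₀ b₀ hab)
        rw [← sum_ite_sub_eq_prod_diffLaw]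
        refine Finset.sum_le_sum fun a _ => Finset.sum_le_sum fun b _ => ?_
        have hnn : 0 ≤ W a * W b := mul_nonneg (hW a) (hW b)
        by_cases hcond : good a b ∧ digitEval B a - digitEval B b = s
        · rw [if_pos hcond, if_pos (digitEval_sub_eq_sub (hcond.2.trans hs.symm))]
        · rw [if_neg hcond]
          split_ifs
          · exact hnn
          · exact le_rfl
      · push Not at hex
        refine le_trans (le_of_eq ?_) (Real.exp_pos _).le
        exact Finset.sum_eq_zero fun a _ => Finset.sum_eq_zero fun b _ =>
          if_neg fun hc => hex a b hc.1 hc.2)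
    (fun a s => sum_le_of_subsingleton_support _ _ _ (Real.exp_pos _).le
      (fun b hb => hW2 a b hb.1) (fun u v hu hv => digitEval_injective
        (sub_right_injective (hu.2.trans hv.2.symm))))
    (fun b s => sum_le_of_subsingleton_support _ _ _ (Real.exp_pos _).le
      (fun a ha => hW1 a b ha.1) (fun u v hu hv => digitEval_injective
        (sub_left_injective (hu.2.trans hv.2.symm))))
  -- Keeping only samples of small digit sum controls the sumset and loses no good pair.
  let T : Finset V := (Finset.univ.image ω).filter fun v => ∑ i, ((v i : ℕ) : ℝ) ≤ l * d
  refine ⟨T.image (digitEval B), ?_, ?_, fun z hz0 hz1 => ?_⟩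
  · have : (T.image (digitEval B)).card ≤ 2 * k := by
      calc _ ≤ T.card := Finset.card_image_le
        _ ≤ (Finset.univ.image ω).card := Finset.card_filter_le _ _
        _ ≤ (Finset.univ : Finset (Fin k ⊕ Fin k)).card := Finset.card_image_le
        _ = 2 * k := by simp; ring
    exact_mod_cast this
  · refine hω.trans ?_
    norm_cast
    refine Finset.card_le_card fun s hs => ?_
    obtain ⟨p, hp, rfl⟩ := Finset.mem_image.1 hs
    have hp' := (Finset.mem_filter.1 hp).2
    exact Finset.sub_mem_sub
      (Finset.mem_image_of_mem _ (Finset.mem_filter.2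
        ⟨Finset.mem_image_of_mem _ (Finset.mem_univ _), hmean1 _ _ hp'⟩))
      (Finset.mem_image_of_mem _ (Finset.mem_filter.2
        ⟨Finset.mem_image_of_mem _ (Finset.mem_univ _), hmean2 _ _ hp'⟩))
  · refine le_trans ?_ (card_filter_sum_le (d := d) (m := 2 * K + 1) (2 * l) z hz0 hz1)
    norm_cast
    refine le_trans (Finset.card_le_card ?_)
      (Finset.card_image_le (f := digitEval B))
    intro s hs
    obtain ⟨x, hx, y, hy, rfl⟩ := Finset.mem_add.1 hs
    obtain ⟨a, ha, rfl⟩ := Finset.mem_image.1 hx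
    obtain ⟨b, hb, rfl⟩ := Finset.mem_image.1 hy
    refine Finset.mem_image.2 ⟨fun i => ⟨(a i : ℕ) + b i, by omega⟩, ?_, ?_⟩
    · have h1 := (Finset.mem_filter.1 ha).2
      have h2 := (Finset.mem_filter.1 hb).2
      simp only [Finset.mem_filter, Finset.mem_univ, true_and]
      push_cast
      rw [Finset.sum_add_distrib]
      linarith
    · simp only [digitEval]
      push_cast
      rw [← Finset.sum_add_distrib]
      exact Finset.sum_congr rfl fun i _ => by ring

/-! ### Numerical estimates for the chosen law. -/

/-- Reduces a bound on log₂ r by a fraction to exact rational arithmetic. -/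
theorem log_le_neg_div_mul_log_two {r : ℝ} (hr : 0 < r) (a b : ℕ) (hb : 0 < b)
    (h : r ^ b * 2 ^ a ≤ 1) : Real.log r ≤ -(a / b : ℝ) * Real.log 2 := by
  have h1 : Real.log (r ^ b * 2 ^ a) ≤ 0 := Real.log_nonpos (by positivity) h
  rw [Real.log_mul (by positivity) (by positivity), Real.log_pow, Real.log_pow] at h1
  have hb' : (0 : ℝ) < b := by exact_mod_cast hb
  rw [neg_mul, div_mul_eq_mul_div, le_neg, div_le_iff₀ hb']
  linarith

/-- A law on `{0, 1, 2, 3}` whose difference law has large entropy compared to its mean. -/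
noncomputable def sampleLaw : Fin (3 + 1) → ℝ := ![1920 / 2050, 119 / 2050, 10 / 2050, 1 / 2050]

theorem sum_fin_three_add_one (f : Fin (3 + 1) → ℝ) : ∑ a, f a = f 0 + f 1 + f 2 + f 3 :=
  Fin.sum_univ_four f

theorem sampleLaw_zero : sampleLaw 0 = 1920 / 2050 := rfl

theorem sampleLaw_one : sampleLaw 1 = 119 / 2050 := rfl

theorem sampleLaw_two : sampleLaw 2 = 10 / 2050 := rfl

theorem sampleLaw_three : sampleLaw 3 = 1 / 2050 := rfl

theorem val_two_fin_three_add_one : ((2 : Fin (3 + 1)) : ℕ) = 2 := rfl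

theorem val_three_fin_three_add_one : ((3 : Fin (3 + 1)) : ℕ) = 3 := rfl

theorem sampleLaw_pos (a : Fin (3 + 1)) : 0 < sampleLaw a := by
  fin_cases a <;> norm_num [sampleLaw]

theorem sum_sampleLaw : ∑ a, sampleLaw a = 1 := by
  norm_num [sum_fin_three_add_one, sampleLaw_zero,
      sampleLaw_one, sampleLaw_two, sampleLaw_three, val_two_fin_three_add_one,
      val_three_fin_three_add_one]

theorem mean_sampleLaw_lt : ∑ a, sampleLaw a * (a : ℕ) < 693 / 10000 := by
  norm_num [sum_fin_three_add_one, sampleLaw_zero,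
      sampleLaw_one, sampleLaw_two, sampleLaw_three, val_two_fin_three_add_one,
      val_three_fin_three_add_one]

theorem entropy_sampleLaw :
    ∑ a, sampleLaw a * Real.log (sampleLaw a) < -(27 / 77 * Real.log 2) := by
  have h0 := log_le_neg_div_mul_log_two (r := 1920 / 2050) (by norm_num) 1 11 (by norm_num)
    (by norm_num)
  have h1 := log_le_neg_div_mul_log_two (r := 119 / 2050) (by norm_num) 4 1 (by norm_num)
    (by norm_num)
  have h2 := log_le_neg_div_mul_log_two (r := 10 / 2050) (by norm_num) 7 1 (by norm_num)
    (by norm_num)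
  have h3 := log_le_neg_div_mul_log_two (r := 1 / 2050) (by norm_num) 11 1 (by norm_num)
    (by norm_num)
  have hl := Real.log_pos one_lt_two
  rw [Fin.sum_univ_four]
  change 1920 / 2050 * Real.log (1920 / 2050) + 119 / 2050 * Real.log (119 / 2050) +
    10 / 2050 * Real.log (10 / 2050) + 1 / 2050 * Real.log (1 / 2050) < _
  push_cast at h0 h1 h2 h3
  linarith

-- This is the binding constraint: the entropy bound obtained is about 0.70135 bits, and 54/77 lies
-- just below it.
set_option exponentiation.threshold 1000 in
theorem entropy_diffLaw_sampleLaw :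
    ∑ a, ∑ b, sampleLaw a * sampleLaw b *
      Real.log (diffLaw sampleLaw (((a : ℕ) : ℤ) - ((b : ℕ) : ℤ))) <
      -(2 * (27 / 77 * Real.log 2)) := by
  have v0 : (((0 : Fin (3 + 1)) : ℕ) : ℤ) = 0 := rfl
  have v1 : (((1 : Fin (3 + 1)) : ℕ) : ℤ) = 1 := rfl
  have v2 : (((2 : Fin (3 + 1)) : ℕ) : ℤ) = 2 := rfl
  have v3 : (((3 : Fin (3 + 1)) : ℕ) : ℤ) = 3 := rfl
  have d0 : diffLaw sampleLaw 0 = 1850331 / 2101250 := by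
    simp only [diffLaw, Fintype.sum_prod_type, sum_fin_three_add_one, sampleLaw_zero,
      sampleLaw_one, sampleLaw_two, sampleLaw_three, v0, v1, v2, v3]
    norm_num
  have d1 : diffLaw sampleLaw 1 = 11484 / 210125 := by
    simp only [diffLaw, Fintype.sum_prod_type, sum_fin_three_add_one, sampleLaw_zero,
      sampleLaw_one, sampleLaw_two, sampleLaw_three, v0, v1, v2, v3]
    norm_num
  have d2 : diffLaw sampleLaw 2 = 19319 / 4202500 := by
    simp only [diffLaw, Fintype.sum_prod_type, sum_fin_three_add_one, sampleLaw_zero,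
      sampleLaw_one, sampleLaw_two, sampleLaw_three, v0, v1, v2, v3]
    norm_num
  have d3 : diffLaw sampleLaw 3 = 96 / 210125 := by
    simp only [diffLaw, Fintype.sum_prod_type, sum_fin_three_add_one, sampleLaw_zero,
      sampleLaw_one, sampleLaw_two, sampleLaw_three, v0, v1, v2, v3]
    norm_num
  have d1' : diffLaw sampleLaw (-1) = 11484 / 210125 := by
    simp only [diffLaw, Fintype.sum_prod_type, sum_fin_three_add_one, sampleLaw_zero,
      sampleLaw_one, sampleLaw_two, sampleLaw_three, v0, v1, v2, v3]
    norm_num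
  have d2' : diffLaw sampleLaw (-2) = 19319 / 4202500 := by
    simp only [diffLaw, Fintype.sum_prod_type, sum_fin_three_add_one, sampleLaw_zero,
      sampleLaw_one, sampleLaw_two, sampleLaw_three, v0, v1, v2, v3]
    norm_num
  have d3' : diffLaw sampleLaw (-3) = 96 / 210125 := by
    simp only [diffLaw, Fintype.sum_prod_type, sum_fin_three_add_one, sampleLaw_zero,
      sampleLaw_one, sampleLaw_two, sampleLaw_three, v0, v1, v2, v3]
    norm_num
  have h0 := log_le_neg_div_mul_log_two (r := 1850331 / 2101250) (by norm_num) 11 60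
    (by norm_num) (by norm_num)
  have h1 := log_le_neg_div_mul_log_two (r := 11484 / 210125) (by norm_num) 130 31
    (by norm_num) (by norm_num)
  have h2 := log_le_neg_div_mul_log_two (r := 19319 / 4202500) (by norm_num) 132 17
    (by norm_num) (by norm_num)
  have h3 := log_le_neg_div_mul_log_two (r := 96 / 210125) (by norm_num) 810 73
    (by norm_num) (by norm_num)
  have hl := Real.log_pos one_lt_two
  push_cast at h0 h1 h2 h3
  simp only [sum_fin_three_add_one, v0, v1, v2, v3, sampleLaw_zero, sampleLaw_one,
    sampleLaw_two, sampleLaw_three, sub_self, sub_zero, zero_sub,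
    show (1 : ℤ) - 2 = -1 by rfl, show (1 : ℤ) - 3 = -2 by rfl, show (2 : ℤ) - 1 = 1 by rfl,
    show (2 : ℤ) - 3 = -1 by rfl, show (3 : ℤ) - 1 = 2 by rfl, show (3 : ℤ) - 2 = 1 by rfl,
    d0, d1, d2, d3, d1', d2', d3']
  linarith

-- The value z = 1/8 is a convenient power of 2 near the minimiser 2l/(1 + 2l) ≈ 0.122. Only log 7
-- then needs an estimate, supplied by 2^306 ≤ 7^109.
set_option exponentiation.threshold 1000 in
theorem sumset_base_le :
    (1 - 1 / 8 : ℝ)⁻¹ * (1 / 8 : ℝ) ^ (-(2 * (693 / 10000 : ℝ))) ≤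
      Real.exp (1.7354 * (27 / 77 * Real.log 2)) := by
  have h := log_le_neg_div_mul_log_two (r := 1 / 7) (by norm_num) 306 109 (by norm_num)
    (by norm_num)
  rw [one_div, Real.log_inv] at h
  have h8 : Real.log (1 / 8) = -(3 * Real.log 2) := by
    rw [show (1 / 8 : ℝ) = (2 ^ 3)⁻¹ by norm_num, Real.log_inv, Real.log_pow]; norm_num
  have h7 : (1 - 1 / 8 : ℝ)⁻¹ = Real.exp (3 * Real.log 2 - Real.log 7) := by
    rw [show 3 * Real.log 2 - Real.log 7 = Real.log (2 ^ 3 / 7) by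
      rw [Real.log_div (by norm_num) (by norm_num), Real.log_pow]; norm_num,
      Real.exp_log (by norm_num)]
    norm_num
  have hl := Real.log_pos one_lt_two
  rw [Real.rpow_def_of_pos (by norm_num), h8, h7, ← Real.exp_add]
  push_cast at h
  refine Real.exp_le_exp.2 ?_
  norm_num at h ⊢
  linarith

/-! ### Choice of dimension and absorption of constants. -/

theorem corollaryC (ε : ℝ) (hε : 0 < ε) (hε2 : ε < 2) :
    ∃ A : Finset ℤ,
      ((A - A).card : ℝ) ≥ (A.card : ℝ) ^ (2 - ε) ∧
      (A.card : ℝ) ^ (2 - ε) > 1 ∧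
      ((A + A).card : ℝ) ≤ (A.card : ℝ) ^ ((1.7354 : ℝ) + ε) := by
  have hev := eventually_exists_finset sampleLaw sampleLaw_pos sum_sampleLaw (693 / 10000)
    (27 / 77 * Real.log 2) mean_sampleLaw_lt entropy_sampleLaw entropy_diffLaw_sampleLaw
  -- With d = 77n, exp(h d) is exactly the integer 2^(27n), which serves as k.
  have hmul : Filter.Tendsto (fun n : ℕ => 77 * n) Filter.atTop Filter.atTop :=
    Filter.tendsto_id.const_mul_atTop' (by norm_num)
  have hk : Filter.Tendsto (fun n : ℕ => ((2 : ℝ) ^ (27 * n)) / 2) Filter.atTop Filter.atTop :=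
    ((tendsto_pow_atTop_atTop_of_one_lt (one_lt_two : (1 : ℝ) < 2)).comp
      (Filter.tendsto_id.const_mul_atTop' (by norm_num))).atTop_div_const two_pos
  have hkε := (tendsto_rpow_atTop hε).comp hk
  obtain ⟨n, hn, hn2, hnε⟩ := ((hmul.eventually hev).and
    ((hk.eventually_ge_atTop 2).and (hkε.eventually_ge_atTop 16))).exists
  simp only [Function.comp_apply] at hnε
  have hkexp : (2 : ℝ) ^ (27 * n) = Real.exp (27 / 77 * Real.log 2 * ((77 * n : ℕ) : ℝ)) := by
    rw [← Real.rpow_natCast, Real.rpow_def_of_pos two_pos]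
    congr 1; push_cast; ring
  obtain ⟨A, hA, hsub, hadd⟩ := hn (2 ^ (27 * n)) (by rw [← hkexp]; push_cast; exact le_rfl)
  have hadd := hadd (1 / 8) (by norm_num) (by norm_num)
  push_cast at hA hsub
  set k : ℝ := (2 : ℝ) ^ (27 * n) with hkdef
  have hk0 : 0 < k := by positivity
  -- The trivial bound |A - A| ≤ |A|² forces A to be large.
  have hcard : k / 2 ≤ A.card := by
    have h1 : ((A - A).card : ℝ) ≤ (A.card : ℝ) ^ 2 := by
      rw [sq]; exact_mod_cast Finset.card_sub_le
    refine le_of_sq_le_sq ?_ (by positivity)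
    linarith [show (k / 2) ^ 2 = k ^ 2 / 4 by ring]
  have hA2 : (2 : ℝ) ≤ A.card := hn2.trans hcard
  have hA0 : (0 : ℝ) < A.card := by linarith
  have hAε : 16 ≤ (A.card : ℝ) ^ ε :=
    hnε.trans (Real.rpow_le_rpow (by positivity) hcard hε.le)
  refine ⟨A, ?_, Real.one_lt_rpow (by linarith) (by linarith), ?_⟩
  -- |A|² ≤ 4k² = 16 · k²/4, and the factor 16 is at most |A|^ε.
  · rw [ge_iff_le, Real.rpow_sub hA0, div_le_iff₀ (by positivity), Real.rpow_two]
    calc (A.card : ℝ) ^ 2 ≤ (2 * k) ^ 2 := pow_le_pow_left₀ hA0.le hA 2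
      _ = k ^ 2 / 4 * 16 := by ring
      _ ≤ _ := mul_le_mul hsub hAε (by norm_num) (by positivity)
  · calc ((A + A).card : ℝ) ≤ Real.exp (1.7354 * (27 / 77 * Real.log 2)) ^ (77 * n) :=
          hadd.trans (pow_le_pow_left₀ (by positivity) sumset_base_le _)
      _ = k ^ (1.7354 : ℝ) := by
          rw [← Real.exp_nat_mul, hkexp, ← Real.exp_mul]
          congr 1; ring
      _ ≤ (2 * A.card) ^ (1.7354 : ℝ) :=
          Real.rpow_le_rpow hk0.le (by linarith) (by norm_num)
      _ = (2 : ℝ) ^ (1.7354 : ℝ) * (A.card : ℝ) ^ (1.7354 : ℝ) :=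
          Real.mul_rpow two_pos.le hA0.le
      _ ≤ (A.card : ℝ) ^ ε * (A.card : ℝ) ^ (1.7354 : ℝ) := by
          refine mul_le_mul_of_nonneg_right (le_trans ?_ hAε) (by positivity)
          calc (2 : ℝ) ^ (1.7354 : ℝ) ≤ 2 ^ (2 : ℝ) :=
                Real.rpow_le_rpow_of_exponent_le one_le_two (by norm_num)
            _ ≤ 16 := by norm_num
      _ = _ := by rw [← Real.rpow_add hA0, add_comm]
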